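/- For $i\in\mathbb N$ let $\mathrm{Q^e\Sigma}_i$, the $i$-th level of the entangled quantum polynomial hierarchy, be the following class of promise problems $L=(L_{\rm yes},L_{\rm no})$ (pairs of disjoint subsets of $\{0,1\}^*$). For $c,s:\mathbb N\to[0,1]$, $L\in \mathrm{Q^e\Sigma}_i(c,s)$ if there are a polynomial $p$ and a deterministic polynomial-time Turing machine that on each input $x$ of length $n$ prints the description of a quantum circuit $V=V_x$ (over the gates Hadamard, $T$, CNOT), whose qubits are split into work qubits, initialised to $|0\rangle$, and proof registers with Hilbert spaces $\mathcal X_1,\dots,\mathcal X_i$ of at most $p(n)$ qubits each, and which accepts if measuring a designated output qubit gives $1$, such that - Completeness: if $x\in L_{\rm yes}$ then $\exists\rho_1\,\forall\rho_2\,\exists\rho_3\cdots Q_i\rho_i:\ \Pr[V(\rho_{i-1},\rho_i)\text{ accepts}]\ge c(n)$; - Soundness: if $x\in L_{\rm no}$ then $\forall\rho_1\,\exists\rho_2\,\forall\rho_3\cdots \overline{Q_i}\rho_i:\ \Pr[V(\rho_{i-1},\rho_i)\text{ accepts}]\le s(n)$. Here $Q_j=\exists$ for odd $j$ and $Q_j=\forall$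 for even $j$, and $\overline{Q_j}$ is the opposite quantifier. The variable $\rho_j$ ranges over the density matrices on $\mathcal X_j\otimes\mathcal X_{j-2}\otimes\mathcal X_{j-4}\otimes\cdots$ (all positive indices of the same parity as $j$) that satisfy $\operatorname{tr}_{\mathcal X_j}(\rho_j)=\rho_{j-2}$ if $j>2$; and $V(\rho_{i-1},\rho_i)$ is $V$ run on $\rho_{i-1}\otimes\rho_i\otimes|0\cdots0\rangle\langle0\cdots0|$, each factor on its own qubits. Finally $\mathrm{Q^e\Sigma}_i=\bigcup \mathrm{Q^e\Sigma}_i(c,s)$, the union being over all polynomial-time computable $c,s:\mathbb N\to[0,1]$ with $c(n)-s(n)\ge 1/q(n)$ for some polynomial $q$ and all sufficiently large $n$. **Lemma.** For every constant $i\ge 2$, $\mathrm{Q^e\Sigma}_2=\mathrm{Q^e\Sigma}_i$. -/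

import Mathlib

open scoped ComplexOrder

noncomputable section

namespace QEPH

/-! ### Promise problems and polynomial-time computable parameters -/

/-- A promise problem: two disjoint sets of bit strings. -/
structure PromiseProblem where
  yes : Set (List Bool)
  no : Set (List Bool)
  disj : Disjoint yes no

/-- The bit string `1^{a₁} 0 1^{a₂} 0 …` of a list of natural numbers `a₁, a₂, …`. -/
def encodeNats (l : List ℕ) : List Bool :=
  l.flatMap fun a => List.replicate a true ++ [false]

/-- `c` is computable in polynomial time: given `n` and a precision `k`, both in unary, a
polynomial-time Turing machine prints (in binary) an integer `a` with `|c n - a / 2 ^ k| ≤ 2 ^ (-k)`.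
-/
def PolyTimeReal (c : ℕ → ℝ) : Prop :=
  ∃ f : ℕ × ℕ → ℕ,
    Nonempty (Turing.TM2ComputableInPolyTime
      (fun q : ℕ × ℕ => encodeNats [q.1, q.2]) Computability.encodeNat f) ∧
    ∀ n k : ℕ, |c n - (f (n, k) : ℝ) / 2 ^ k| ≤ 1 / 2 ^ k

/-! ### Quantum circuits -/

/-- Gates on `n` qubits: Hadamard, `T` (the `π/8` gate), and controlled-not. -/
inductive Gate (n : ℕ) where
  | H (q : Fin n)
  | T (q : Fin n)
  | CNOT (control target : Fin n) (ne : control ≠ target)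

/-- The matrix of a one-qubit operator `M` acting on qubit `q` of an `n`-qubit register. -/
def onQubit {n : ℕ} (q : Fin n) (M : Matrix Bool Bool ℂ) :
    Matrix (Fin n → Bool) (Fin n → Bool) ℂ :=
  Matrix.of fun u v => if ∀ w, w ≠ q → u w = v w then M (u q) (v q) else 0

/-- The Hadamard matrix. -/
def hadamard : Matrix Bool Bool ℂ :=
  Matrix.of fun a b => (if a = true ∧ b = true then -1 else 1) / (Real.sqrt 2 : ℂ)

/-- The matrix `diag(1, exp(iπ/4))`. -/
def tGate : Matrix Bool Bool ℂ :=
  Matrix.diagonal fun a => if a = true then Complex.exp (Real.pi / 4 * Complex.I) else 1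

/-- The unitary matrix of a gate in the computational basis. -/
def Gate.matrix {n : ℕ} : Gate n → Matrix (Fin n → Bool) (Fin n → Bool) ℂ
  | .H q => onQubit q hadamard
  | .T q => onQubit q tGate
  | .CNOT a b _ => Matrix.of fun u v => if u = Function.update v b (xor (v b) (v a)) then 1 else 0

/-- The description of a verification circuit. Every one of its `wires` qubits is announced either
as a work qubit (`label w = 0`), initialised to `|0⟩`, or as a qubit of the proof register that is
handed over in turn `label w ≥ 1`. The gates are applied in the order of the list, and finally the
qubit `out` is measured in the computational basis; the outcome `1` means acceptance. -/
structure Circuit where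
  wires : ℕ
  label : Fin wires → ℕ
  gates : List (Gate wires)
  out : Fin wires

/-- A gate as a record of three numbers. -/
def Gate.toNats {n : ℕ} : Gate n → List ℕ
  | .H q => [0, q, q]
  | .T q => [1, q, q]
  | .CNOT a b _ => [2, a, b]

/-- A circuit as a list of numbers. -/
def Circuit.toNats (V : Circuit) : List ℕ :=
  V.wires :: (List.ofFn V.label ++ (V.out : ℕ) :: V.gates.flatMap Gate.toNats)

/-- The bit string that describes a circuit; its length is at least the number of qubits plus the
number of gates. -/
def Circuit.encode (V : Circuit) : List Bool :=
  encodeNats V.toNats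

theorem encodeNats_injective : Function.Injective encodeNats := by
  intro l
  induction l with
  | nil =>
    intro l' h
    cases l' with
    | nil => rfl
    | cons b l' => simp [encodeNats] at h
  | cons a l ih =>
    intro l' h
    cases l' with
    | nil => simp [encodeNats] at h
    | cons b l' =>
      have key : ∀ (a b : ℕ) (x y : List Bool),
          List.replicate a true ++ false :: x = List.replicate b true ++ false :: y →
            a = b ∧ x = y := by
        intro a
        induction a with
        | zero =>
          intro b x y h
          cases b with
          | zero => simpa using h
          | succ b => simp [List.replicate_succ] at h
        | succ a iha =>
          intro b x y h
          cases b with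
          | zero => simp [List.replicate_succ] at h
          | succ b =>
            have := iha b x y (by simpa [List.replicate_succ] using h)
            simpa using this
      have h2 := key a b (encodeNats l) (encodeNats l') (by simpa [encodeNats] using h)
      rw [h2.1, ih h2.2]

theorem Gate.toNats_injective {n : ℕ} : Function.Injective (Gate.toNats (n := n)) := by
  intro g g' h
  cases g <;> cases g' <;> simp_all [Gate.toNats, Fin.ext_iff]

/-- Different circuits have different descriptions. -/
theorem Circuit.encode_injective : Function.Injective Circuit.encode := by
  rintro ⟨n, l, g, o⟩ ⟨n', l', g', o'⟩ h
  have h1 := encodeNats_injective h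
  simp only [Circuit.toNats, List.cons.injEq] at h1
  obtain ⟨rfl, h2⟩ := h1
  obtain ⟨h3, h4⟩ := List.append_inj h2 (by simp)
  have hl : l = l' := List.ofFn_injective h3
  simp only [List.cons.injEq] at h4
  have ho : o = o' := Fin.ext h4.1
  have hg : ∀ g g' : List (Gate n), g.flatMap Gate.toNats = g'.flatMap Gate.toNats → g = g' := by
    have len : ∀ a : Gate n, a.toNats.length = 3 := by intro a; cases a <;> rfl
    intro g
    induction g with
    | nil =>
      intro g' h
      cases g' with
      | nil => rfl
      | cons b g' =>
        have := congrArg List.length h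
        simp [len] at this
        omega
    | cons a g ih =>
      intro g' h
      cases g' with
      | nil =>
        have := congrArg List.length h
        simp [len] at this
      | cons b g' =>
        simp only [List.flatMap_cons] at h
        obtain ⟨e1, e2⟩ := List.append_inj h (by rw [len, len])
        rw [Gate.toNats_injective e1, ih g' e2]
  rw [hl, ho, hg g g' h4.2]

/-- The unitary matrix of the circuit (the first gate of the list acts first). -/
def Circuit.unitary (V : Circuit) : Matrix (Fin V.wires → Bool) (Fin V.wires → Bool) ℂ :=
  V.gates.foldl (fun U g => g.matrix * U) 1

/-- The projection on the outcome `1` of the output qubit. -/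
def Circuit.outProj (V : Circuit) : Matrix (Fin V.wires → Bool) (Fin V.wires → Bool) ℂ :=
  Matrix.diagonal fun u => if u V.out = true then 1 else 0

/-! ### Density matrices on sets of qubits -/

/-- The density matrices on the set `S` of qubits: positive semidefinite with trace one, the basis
of the Hilbert space being indexed by the bit assignments to `S`. -/
structure Density {n : ℕ} (S : Finset (Fin n)) where
  mat : Matrix (S → Bool) (S → Bool) ℂ
  posSemidef : mat.PosSemidef
  trace_eq_one : mat.trace = 1

/-- The assignment to `T` that agrees with `u` on `S` and with `z` on `T \ S`. -/
def glue {n : ℕ} {S T : Finset (Fin n)} (u : S → Bool) (z : ↥(T \ S) → Bool) : T → Bool :=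
  fun w => if h : w.1 ∈ S then u ⟨w.1, h⟩ else z ⟨w.1, Finset.mem_sdiff.2 ⟨w.2, h⟩⟩

/-- For `S ⊆ T`: the partial trace over the qubits in `T \ S`, from operators on `T` to operators
on `S`. -/
def partialTrace {n : ℕ} (S : Finset (Fin n)) {T : Finset (Fin n)}
    (ρ : Matrix (T → Bool) (T → Bool) ℂ) : Matrix (S → Bool) (S → Bool) ℂ :=
  Matrix.of fun u v => ∑ z : ↥(T \ S) → Bool, ρ (glue u z) (glue v z)

/-- For disjoint `S` and `T`: the state `ρ ⊗ σ ⊗ |0…0⟩⟨0…0|` of all `n` qubits, with `ρ` on `S`,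
`σ` on `T`, and `|0⟩` on every other qubit. -/
def jointState {n : ℕ} {S T : Finset (Fin n)} (ρ : Density S) (σ : Density T) :
    Matrix (Fin n → Bool) (Fin n → Bool) ℂ :=
  Matrix.of fun u v =>
    if ∀ w, w ∉ S ∪ T → u w = false ∧ v w = false then
      ρ.mat (fun w => u w.1) (fun w => v w.1) * σ.mat (fun w => u w.1) (fun w => v w.1)
    else 0

/-- The probability that the circuit accepts when its qubits in `S` and `T` are prepared in the
states `ρ` and `σ` and all other qubits in `|0⟩`, namely `tr(Π U (ρ ⊗ σ ⊗ |0…0⟩⟨0…0|) U†)`. -/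
def Circuit.acceptProb (V : Circuit) {S T : Finset (Fin V.wires)}
    (ρ : Density S) (σ : Density T) : ℝ :=
  ((V.outProj * (V.unitary * jointState ρ σ * V.unitary.conjTranspose)).trace).re

/-- The state in which all qubits of `S` are `|0⟩`. -/
def zeroState {n : ℕ} (S : Finset (Fin n)) : Density S :=
  ⟨Matrix.vecMulVec (Pi.single (fun _ => false) 1) (star (Pi.single (fun _ => false) 1)),
    Matrix.posSemidef_vecMulVec_self_star _, by
      simp [Matrix.trace_vecMulVec, dotProduct, Pi.single_apply]⟩

/-! ### The game with `i` alternating, possibly entangled proofs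

The turns are `1, …, i`. One player moves in the odd turns, the other one in the even turns. In
turn `j` the mover reveals the joint state of all registers that she has handed over so far. -/

/-- The turn in which qubit `w` is handed over in the game with `i` turns, `0` standing for a work
qubit. This is `V.label w`, except that the game ends after turn `i`: a qubit announced for a turn
after `i` belongs to the register of the last turn of its owner (the mover in the turns of the same
parity), and it is a work qubit if its owner has no turn. -/
def Circuit.turn (V : Circuit) (i : ℕ) (w : Fin V.wires) : ℕ :=
  if V.label w ≤ i then V.label w
  else if V.label w % 2 = i % 2 then i else i - 1

/-- The qubits of the register `𝒳_j` that is handed over in turn `j ≥ 1`. -/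
def Circuit.register (V : Circuit) (i j : ℕ) : Finset (Fin V.wires) :=
  {w | V.turn i w = j}

/-- The qubits of `𝒳_j, 𝒳_{j-2}, 𝒳_{j-4}, …`, all indices being positive: what the mover of turn `j`
has handed over after that turn. -/
def Circuit.held (V : Circuit) (i j : ℕ) : Finset (Fin V.wires) :=
  {w | 1 ≤ V.turn i w ∧ V.turn i w ≤ j ∧ V.turn i w % 2 = j % 2}

/-- The remaining quantifiers of the game with `i` turns, when `k` turns are left, turn `j` has been
played, and `prev`, `cur` are the states `ρ_{j-1}`, `ρ_j`. Turns whose parity is that of `e` are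
quantified existentially, the others universally; turn `j + 1` ranges over the density matrices
`ρ_{j+1}` whose partial trace over `𝒳_{j+1}` is `ρ_{j-1}`; and after the last turn the acceptance
probability on `(ρ_{i-1}, ρ_i)` has to satisfy `win`. (If `j + 1 ≤ 2` then no qubit is held before,
and the condition on the partial trace says that the trace is one.) -/
def Circuit.play (V : Circuit) (i e : ℕ) (win : ℝ → Prop) :
    (k j : ℕ) → Density (V.held i (j - 1)) → Density (V.held i j) → Prop
  | 0, _, prev, cur => win (V.acceptProb prev cur)
  | k + 1, j, prev, cur =>
    if (j + 1) % 2 = e % 2 then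
      ∃ next : Density (V.held i (j + 1)),
        partialTrace (V.held i (j - 1)) next.mat = prev.mat ∧ V.play i e win k (j + 1) cur next
    else
      ∀ next : Density (V.held i (j + 1)),
        partialTrace (V.held i (j - 1)) next.mat = prev.mat → V.play i e win k (j + 1) cur next

/-- `∃ ρ₁ ∀ ρ₂ ∃ ρ₃ … Q_i ρ_i : Pr[V(ρ_{i-1}, ρ_i) accepts] ≥ c`. -/
def Circuit.Complete (V : Circuit) (i : ℕ) (c : ℝ) : Prop :=
  V.play i 1 (fun p => c ≤ p) i 0 (zeroState _) (zeroState _)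

/-- `∀ ρ₁ ∃ ρ₂ ∀ ρ₃ … Q̄_i ρ_i : Pr[V(ρ_{i-1}, ρ_i) accepts] ≤ s`. -/
def Circuit.Sound (V : Circuit) (i : ℕ) (s : ℝ) : Prop :=
  V.play i 0 (fun p => p ≤ s) i 0 (zeroState _) (zeroState _)

/-! ### The entangled quantum polynomial hierarchy -/

/-- The `i`-th level with completeness `c` and soundness `s`: a polynomial-time Turing machine
prints on every input `x` the description of a circuit `V x` whose proof registers have at most
`p(|x|)` qubits, and `V x` has the completeness and soundness property. -/
def QESigmaWith (i : ℕ) (c s : ℕ → ℝ) : Set PromiseProblem :=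
  {L | ∃ V : List Bool → Circuit,
    Nonempty (Turing.TM2ComputableInPolyTime (id : List Bool → List Bool) Circuit.encode V) ∧
    (∃ p : Polynomial ℕ, ∀ x : List Bool, ∀ j : ℕ, 1 ≤ j → j ≤ i →
      ((V x).register i j).card ≤ p.eval x.length) ∧
    (∀ x ∈ L.yes, (V x).Complete i (c x.length)) ∧
    (∀ x ∈ L.no, (V x).Sound i (s x.length))}

/-- The `i`-th level of the entangled quantum polynomial hierarchy: the union of the classes with
polynomial-time computable `c, s : ℕ → [0,1]` such that `c - s ∈ Ω(1 / poly(n))`. -/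
def QESigma (i : ℕ) : Set PromiseProblem :=
  {L | ∃ c s : ℕ → ℝ,
    PolyTimeReal c ∧ PolyTimeReal s ∧
    (∀ n, c n ∈ Set.Icc (0 : ℝ) 1) ∧ (∀ n, s n ∈ Set.Icc (0 : ℝ) 1) ∧
    (∃ q : Polynomial ℕ, ∀ᶠ n : ℕ in Filter.atTop,
      0 < q.eval n ∧ 1 / ((q.eval n : ℕ) : ℝ) ≤ c n - s n) ∧
    L ∈ QESigmaWith i c s}

end QEPH

end

open scoped ComplexOrder

noncomputable section

/-! The number of turns does not affect who wins, as long as both players move. Acceptance depends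
only on the final states of the two players and is bilinear in them. The density matrices form a
compact convex set, so the minimax theorem gives a saddle point (`Circuit.exists_saddlePoint`). A
player with a final state `ω` that is good against all opposing final states wins every such game by
revealing reductions of `ω`, which satisfy the consistency conditions whatever the opponent shows
(`play_of_restrict`). If the player has no such state, the saddle point gives the opponent one, so
the negated game is won.

Hence completeness and soundness become statements about final states in which `i` does not occur
(`complete_iff`, `sound_iff`). The same circuit serves at both levels, since labels beyond the last
turn are reassigned to their owner's last register; only the bound on register sizes has to be
adjusted. -/

/-- Von Neumann's minimax theorem: a real bilinear form on finite-dimensional spaces has a saddle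
point on every product of nonempty compact convex sets. -/
theorem LinearMap.exists_saddlePoint {E F : Type*}
    [AddCommGroup E] [Module ℝ E] [TopologicalSpace E] [IsTopologicalAddGroup E]
    [ContinuousSMul ℝ E] [T2Space E] [FiniteDimensional ℝ E]
    [AddCommGroup F] [Module ℝ F] [TopologicalSpace F] [IsTopologicalAddGroup F]
    [ContinuousSMul ℝ F] [T2Space F] [FiniteDimensional ℝ F]
    (f : E →ₗ[ℝ] F →ₗ[ℝ] ℝ) {X : Set E} {Y : Set F}
    (neX : X.Nonempty) (cX : Convex ℝ X) (kX : IsCompact X)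
    (neY : Y.Nonempty) (cY : Convex ℝ Y) (kY : IsCompact Y) :
    ∃ a ∈ X, ∃ b ∈ Y, ∀ x ∈ X, ∀ y ∈ Y, f a y ≤ f x b :=
  Sion.exists_isSaddlePointOn' (f := fun x y => f x y) neX kX
    (fun y _ => (f.flip y).continuous_of_finiteDimensional.lowerSemicontinuous.lowerSemicontinuousOn
      X)
    (fun y _ => ((f.flip y).convexOn cX).quasiconvexOn) cY kY
    (fun x _ => (f x).continuous_of_finiteDimensional.upperSemicontinuous.upperSemicontinuousOn Y)
    (fun x _ => ((f x).concaveOn cY).quasiconcaveOn) cX neY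

/-! ### Compactness and convexity of the set of density matrices. -/

/-- The entries of a positive semidefinite matrix of trace one have norm at most one. -/
theorem Matrix.PosSemidef.norm_apply_le_one {n : Type*} [Fintype n] {A : Matrix n n ℂ}
    (hA : A.PosSemidef) (htr : A.trace = 1) (i j : n) : ‖A i j‖ ≤ 1 := by
  have hdiag : ∀ k, ∃ r : ℝ, A k k = r ∧ 0 ≤ r ∧ r ≤ 1 := by
    intro k
    have h0 : 0 ≤ A k k := hA.diag_nonneg
    have h1 : A k k ≤ 1 := htr ▸ Finset.single_le_sum (f := fun k => A k k)
      (fun l _ => hA.diag_nonneg) (Finset.mem_univ k)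
    obtain ⟨a0, a1⟩ := Complex.le_def.1 h0
    refine ⟨(A k k).re, Complex.ext rfl (by simpa using a1.symm), by simpa using a0, ?_⟩
    simpa using (Complex.le_def.1 h1).1
  obtain ⟨r, hr, r0, r1⟩ := hdiag i
  obtain ⟨s, hs, s0, s1⟩ := hdiag j
  -- The principal minor on `i, j` gives `‖A i j‖ ^ 2 ≤ r * s ≤ 1`; for `i = j` the minor vanishes
  -- and the bound still holds.
  have hdet := (hA.submatrix ![i, j]).det_nonneg
  have hji : A j i = star (A i j) := (hA.1.apply j i).symm
  rw [Matrix.det_fin_two] at hdet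
  simp only [Matrix.submatrix_apply, Matrix.cons_val_zero, Matrix.cons_val_one, hji, hr, hs,
    Complex.star_def, Complex.mul_conj, Complex.normSq_eq_norm_sq] at hdet
  have h2 : 0 ≤ r * s - ‖A i j‖ ^ 2 := by exact_mod_cast hdet
  nlinarith [norm_nonneg (A i j)]

/-- The positive semidefinite matrices of trace one. -/
def Matrix.densitySet (n : Type*) [Fintype n] : Set (Matrix n n ℂ) :=
  {A | A.PosSemidef ∧ A.trace = 1}

theorem Matrix.convex_densitySet (n : Type*) [Fintype n] : Convex ℝ (Matrix.densitySet n) := by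
  rintro A ⟨hA, tA⟩ B ⟨hB, tB⟩ a b ha hb hab
  refine ⟨(hA.smul ha).add (hB.smul hb), ?_⟩
  rw [Matrix.trace_add, Matrix.trace_smul, Matrix.trace_smul, tA, tB, ← add_smul, hab, one_smul]

theorem Matrix.isCompact_densitySet (n : Type*) [Fintype n] :
    IsCompact (Matrix.densitySet n) := by
  have hK : IsCompact (Set.univ.pi fun _ : n => Set.univ.pi fun _ : n =>
      Metric.closedBall (0 : ℂ) 1) :=
    isCompact_univ_pi fun _ => isCompact_univ_pi fun _ => isCompact_closedBall _ _
  refine IsCompact.of_isClosed_subset (X := Matrix n n ℂ) hK ?_ ?_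
  · have : Matrix.densitySet n = {A : Matrix n n ℂ | A.conjTranspose = A} ∩
        (⋂ x : n → ℂ, {A | 0 ≤ star x ⬝ᵥ (A.mulVec x)}) ∩ {A | A.trace = 1} := by
      ext A
      simp [Matrix.densitySet, Matrix.posSemidef_iff_dotProduct_mulVec, Matrix.IsHermitian]
    rw [this]
    refine ((isClosed_eq (by fun_prop) continuous_id).inter (isClosed_iInter fun x => ?_)).inter
      (isClosed_eq (by fun_prop) continuous_const)
    exact isClosed_le continuous_const (by fun_prop)
  · rintro A ⟨hA, tA⟩ i - j -
    simpa using hA.norm_apply_le_one tA i j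

namespace QEPH

/-! ### Partial traces -/

section PartialTrace

variable {n : ℕ} {S T U : Finset (Fin n)}

/-- Assignments to a disjoint union are pairs of assignments. -/
def mergeEquiv {A B C : Finset (Fin n)} (hC : C = A ∪ B) (hAB : Disjoint A B) :
    (A → Bool) × (B → Bool) ≃ (C → Bool) where
  toFun p w := if h : w.1 ∈ A then p.1 ⟨w.1, h⟩
    else p.2 ⟨w.1, by simpa [hC, h] using w.2⟩
  invFun f := (fun w => f ⟨w.1, hC ▸ Finset.mem_union_left _ w.2⟩,
    fun w => f ⟨w.1, hC ▸ Finset.mem_union_right _ w.2⟩)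
  left_inv p := by
    refine Prod.ext (funext fun w => ?_) (funext fun w => ?_)
    · simp
    · have : w.1 ∉ A := fun h => Finset.disjoint_left.1 hAB h w.2
      simp [this]
  right_inv f := by
    funext w
    dsimp only
    split_ifs <;> rfl

theorem trace_partialTrace (hST : S ⊆ T) (ρ : Matrix (T → Bool) (T → Bool) ℂ) :
    (partialTrace S ρ).trace = ρ.trace := by
  simp only [Matrix.trace, Matrix.diag, partialTrace, Matrix.of_apply]
  rw [← Fintype.sum_prod_type']
  exact Fintype.sum_equiv
    (mergeEquiv (Finset.union_sdiff_of_subset hST).symm Finset.disjoint_sdiff) _ _ fun _ => rfl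

/-- An assignment to `U \ S` is a pair of assignments to `T \ S` and `U \ T`, so the double sum is a
single one. This makes the reductions of one final state consistent with each other. -/
theorem partialTrace_partialTrace (hST : S ⊆ T) (hTU : T ⊆ U)
    (ρ : Matrix (U → Bool) (U → Bool) ℂ) :
    partialTrace S (partialTrace T ρ) = partialTrace S ρ := by
  have hC : U \ S = (T \ S) ∪ (U \ T) := by
    ext w
    have := @hST w
    have := @hTU w
    simp only [Finset.mem_sdiff, Finset.mem_union]
    tauto
  have hd : Disjoint (T \ S) (U \ T) := Finset.disjoint_left.2 fun w h h' =>
    (Finset.mem_sdiff.1 h').2 (Finset.mem_sdiff.1 h).1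
  have key : ∀ (u : S → Bool) (p : (↥(T \ S) → Bool) × (↥(U \ T) → Bool)),
      (glue (glue u p.1) p.2 : U → Bool) = glue u (mergeEquiv hC hd p) := by
    intro u p
    funext w
    by_cases hS : w.1 ∈ S
    · simp [glue, hS, hST hS]
    · by_cases hT : w.1 ∈ T <;> simp [glue, mergeEquiv, hS, hT]
  ext u v
  simp only [partialTrace, Matrix.of_apply]
  rw [← Fintype.sum_prod_type']
  exact Fintype.sum_equiv (mergeEquiv hC hd) _ _ fun p => by rw [key, key]

theorem partialTrace_self (ρ : Matrix (T → Bool) (T → Bool) ℂ) : partialTrace T ρ = ρ := by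
  have : IsEmpty ↥(T \ T) := ⟨fun w => (Finset.mem_sdiff.1 w.2).2 (Finset.mem_sdiff.1 w.2).1⟩
  have h : ∀ (u : T → Bool) (z : ↥(T \ T) → Bool), glue u z = u := by
    intro u z
    funext w
    simp [glue]
  ext u v
  simp [partialTrace, h]

theorem posSemidef_partialTrace {ρ : Matrix (T → Bool) (T → Bool) ℂ} (hρ : ρ.PosSemidef) :
    (partialTrace S ρ).PosSemidef := by
  have : partialTrace S ρ =
      ∑ z : ↥(T \ S) → Bool, ρ.submatrix (fun u => glue u z) (fun u => glue u z) := by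
    ext u v
    simp [partialTrace, Matrix.sum_apply]
  rw [this]
  exact Matrix.posSemidef_sum _ fun z _ => hρ.submatrix _

/-- The reduced state on a subset of the qubits. -/
def Density.restrict (hST : S ⊆ T) (ρ : Density T) : Density S :=
  ⟨partialTrace S ρ.mat, posSemidef_partialTrace ρ.posSemidef,
    (trace_partialTrace hST _).trans ρ.trace_eq_one⟩

/-- Without qubits the matrix is a scalar, fixed by the trace. This covers the initial states of the
game. -/
theorem Density.mat_eq_of_eq_empty (hS : S = ∅) (ρ σ : Density S) : ρ.mat = σ.mat := by
  subst hS
  have hρ := ρ.trace_eq_one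
  have hσ := σ.trace_eq_one
  simp only [Matrix.trace, Fintype.sum_unique, Matrix.diag] at hρ hσ
  ext u v
  rw [Unique.eq_default u, Unique.eq_default v]
  exact hρ.trans hσ.symm

end PartialTrace

/-! ### The acceptance probability as a bilinear form -/

namespace Circuit

variable (V : Circuit)

/-- The acceptance probability, extended to a bilinear form on all matrices. -/
def acceptForm (S T : Finset (Fin V.wires)) :
    Matrix (S → Bool) (S → Bool) ℂ →ₗ[ℝ] Matrix (T → Bool) (T → Bool) ℂ →ₗ[ℝ] ℝ :=
  -- The formula of `jointState`, freed from positivity and trace one so that linearity makes sense.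
  let J (A : Matrix (S → Bool) (S → Bool) ℂ) (B : Matrix (T → Bool) (T → Bool) ℂ) :
      Matrix (Fin V.wires → Bool) (Fin V.wires → Bool) ℂ :=
    Matrix.of fun u v => if ∀ w, w ∉ S ∪ T → u w = false ∧ v w = false then
      A (fun w => u w.1) (fun w => v w.1) * B (fun w => u w.1) (fun w => v w.1) else 0
  let L : Matrix (Fin V.wires → Bool) (Fin V.wires → Bool) ℂ →ₗ[ℝ] ℝ :=
    { toFun := fun M => ((V.outProj * (V.unitary * M * V.unitary.conjTranspose)).trace).re
      map_add' := fun M N => by simp [mul_add, add_mul]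
      map_smul' := fun r M => by simp }
  LinearMap.mk₂ ℝ (fun A B => L (J A B))
    (fun A A' B => by
      rw [← map_add]; congr 1; ext u v
      simp only [J, Matrix.of_apply, Matrix.add_apply]; split_ifs <;> ring)
    (fun r A B => by
      rw [← map_smul]; congr 1; ext u v
      simp only [J, Matrix.of_apply, Matrix.smul_apply]; split_ifs <;> simp [mul_assoc])
    (fun A B B' => by
      rw [← map_add]; congr 1; ext u v
      simp only [J, Matrix.of_apply, Matrix.add_apply]; split_ifs <;> ring)
    (fun r A B => by
      rw [← map_smul]; congr 1; ext u v
      simp only [J, Matrix.of_apply, Matrix.smul_apply]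
      split_ifs <;> simp [mul_left_comm])

theorem acceptForm_apply {S T : Finset (Fin V.wires)} (ρ : Density S) (σ : Density T) :
    V.acceptForm S T ρ.mat σ.mat = V.acceptProb ρ σ := rfl

/-- Needed because the parity of `i` decides which player's state comes first in the final
evaluation. -/
theorem acceptProb_comm {S T : Finset (Fin V.wires)} (ρ : Density S) (σ : Density T) :
    V.acceptProb ρ σ = V.acceptProb σ ρ := by
  have : jointState ρ σ = jointState σ ρ := by
    ext u v
    simp only [jointState, Matrix.of_apply, Finset.union_comm S T, mul_comm]
  simp only [acceptProb, this]

/-- The two players have optimal states. -/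
theorem exists_saddlePoint (S T : Finset (Fin V.wires)) :
    ∃ (a : Density S) (b : Density T), ∀ (x : Density S) (y : Density T),
      V.acceptProb a y ≤ V.acceptProb x b := by
  obtain ⟨A, hA, B, hB, h⟩ := (V.acceptForm S T).exists_saddlePoint
    (X := Matrix.densitySet _) (Y := Matrix.densitySet _)
    ⟨(zeroState S).mat, (zeroState S).posSemidef, (zeroState S).trace_eq_one⟩
    (Matrix.convex_densitySet _) (Matrix.isCompact_densitySet _)
    ⟨(zeroState T).mat, (zeroState T).posSemidef, (zeroState T).trace_eq_one⟩
    (Matrix.convex_densitySet _) (Matrix.isCompact_densitySet _)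
  exact ⟨⟨A, hA.1, hA.2⟩, ⟨B, hB.1, hB.2⟩, fun x y =>
    h x.mat ⟨x.posSemidef, x.trace_eq_one⟩ y.mat ⟨y.posSemidef, y.trace_eq_one⟩⟩

/-! ### The game -/

/-- All proof qubits of the player who moves in the turns of the parity of `e`. -/
def owned (e : ℕ) : Finset (Fin V.wires) :=
  {w | V.label w ≠ 0 ∧ V.label w % 2 = e % 2}

theorem mem_owned {e : ℕ} {w : Fin V.wires} :
    w ∈ V.owned e ↔ V.label w ≠ 0 ∧ V.label w % 2 = e % 2 := by
  simp [owned]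

theorem mem_held {i j : ℕ} {w : Fin V.wires} :
    w ∈ V.held i j ↔ 1 ≤ V.turn i w ∧ V.turn i w ≤ j ∧ V.turn i w % 2 = j % 2 := by
  simp [held]

theorem mem_register {i j : ℕ} {w : Fin V.wires} : w ∈ V.register i j ↔ V.turn i w = j := by
  simp [register]

theorem owned_congr {e e' : ℕ} (h : e % 2 = e' % 2) : V.owned e = V.owned e' := by
  simp only [owned, h]

/-- Moving a late label to turn `i` or `i - 1` preserves its parity. -/
theorem held_subset_owned {i : ℕ} (hi : 2 ≤ i) (j : ℕ) : V.held i j ⊆ V.owned j := by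
  intro w
  simp only [mem_held, mem_owned, turn]
  split_ifs <;> omega

/-- Here `j` is `i` or `i - 1`, the last turn of one of the players. Since `i - 1 ≥ 1`, no proof
qubit degenerates to a work qubit. -/
theorem held_eq_owned {i j : ℕ} (hi : 2 ≤ i) (hji : j ≤ i) (hij : i ≤ j + 1) :
    V.held i j = V.owned j := by
  refine Finset.Subset.antisymm (V.held_subset_owned hi j) fun w => ?_
  simp only [mem_held, mem_owned, turn]
  split_ifs <;> omega

theorem held_zero (i : ℕ) : V.held i 0 = ∅ := by
  ext w
  simp only [mem_held, Finset.notMem_empty, iff_false]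
  omega

/-- For `j = 0` truncated subtraction makes the left side `held i 0`, which is empty. -/
theorem held_pred_subset (i j : ℕ) : V.held i (j - 1) ⊆ V.held i (j + 1) := by
  intro w
  simp only [mem_held]
  omega

/-- The negation of a game is the game with the opposite quantifiers. -/
theorem not_play (i : ℕ) {e e' : ℕ} (he : (e + e') % 2 = 1) (win : ℝ → Prop) (k j : ℕ)
    (prev : Density (V.held i (j - 1))) (cur : Density (V.held i j)) :
    ¬ V.play i e win k j prev cur ↔ V.play i e' (fun p => ¬ win p) k j prev cur := by
  induction k generalizing j with
  | zero => rfl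
  | succ k ih =>
    by_cases h : (j + 1) % 2 = e % 2
    · have h' : ¬ (j + 1) % 2 = e' % 2 := by omega
      simp only [play, if_pos h, if_neg h', not_exists, not_and, ← ih]
    · have h' : (j + 1) % 2 = e' % 2 := by omega
      simp only [play, if_neg h, if_pos h', not_forall, ← ih, exists_prop]

/-- A player who has a winning final state `ω` wins by always showing the reduced states of `ω`. -/
theorem play_of_restrict {i : ℕ} (hi : 2 ≤ i) {e e' : ℕ} (he : (e + e') % 2 = 1)
    {win : ℝ → Prop} (ω : Density (V.owned e))
    (hω : ∀ τ : Density (V.owned e'), win (V.acceptProb ω τ))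
    (k j : ℕ) (hkj : j + k = i)
    (prev : Density (V.held i (j - 1))) (cur : Density (V.held i j))
    (hprev : j % 2 ≠ e % 2 → prev.mat = partialTrace _ ω.mat)
    (hcur : j % 2 = e % 2 → cur.mat = partialTrace _ ω.mat) :
    V.play i e win k j prev cur := by
  -- `S` and `T` are kept variable so that the equalities with the owned sets can be substituted in
  -- the dependent types of the states.
  have final : ∀ S T : Finset (Fin V.wires), S = V.owned e → T = V.owned e' →
      ∀ (ρ : Density S) (τ : Density T), ρ.mat = partialTrace S ω.mat →
        win (V.acceptProb ρ τ) := by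
    rintro _ _ rfl rfl ρ τ h
    rw [partialTrace_self] at h
    rw [← acceptForm_apply, h]
    exact hω τ
  induction k generalizing j with
  | zero =>
    obtain rfl : j = i := hkj
    by_cases h : j % 2 = e % 2
    · rw [play, acceptProb_comm]
      refine final _ _ ?_ ?_ cur prev (hcur h)
      · exact (V.held_eq_owned hi le_rfl (by omega)).trans (V.owned_congr h)
      · exact (V.held_eq_owned hi (by omega) (by omega)).trans (V.owned_congr (by omega))
    · rw [play]
      refine final _ _ ?_ ?_ prev cur (hprev h)
      · exact (V.held_eq_owned hi (by omega) (by omega)).trans (V.owned_congr (by omega))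
      · exact (V.held_eq_owned hi le_rfl (by omega)).trans (V.owned_congr (by omega))
  | succ k ih =>
    by_cases h : (j + 1) % 2 = e % 2
    · have hsub : V.held i (j + 1) ⊆ V.owned e :=
        (V.held_subset_owned hi _).trans (V.owned_congr h).subset
      rw [play, if_pos h]
      -- The previous state of this player is also a reduction of `ω`, so consistency is
      -- transitivity of the partial trace.
      refine ⟨ω.restrict hsub, ?_, ih _ (by omega) _ _ (fun h' => absurd h h') fun _ => rfl⟩
      rw [hprev (by omega)]
      exact partialTrace_partialTrace (V.held_pred_subset i j) hsub _
    · rw [play, if_neg h]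
      -- The opponent's consistency condition can be dropped, as `ω` is good against every final
      -- state.
      exact fun next _ => ih _ (by omega) _ _ (fun _ => hcur (by omega)) fun h' => absurd h' h

theorem play_start_of_winning {i : ℕ} (hi : 2 ≤ i) {e e' : ℕ} (he : (e + e') % 2 = 1)
    {win : ℝ → Prop} (ω : Density (V.owned e))
    (hω : ∀ τ : Density (V.owned e'), win (V.acceptProb ω τ)) :
    V.play i e win i 0 (zeroState _) (zeroState _) := by
  have h0 : V.held i 0 ⊆ V.owned e := by simp [held_zero]
  have h : (zeroState (V.held i 0)).mat = partialTrace _ ω.mat :=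
    Density.mat_eq_of_eq_empty (V.held_zero i) _ (ω.restrict h0)
  exact V.play_of_restrict hi he ω hω i 0 (by omega) _ _ (fun _ => h) (fun _ => h)

/-- With at least two turns, completeness says that the first player has a final state which is good
against every final state of the second player. -/
theorem complete_iff {i : ℕ} (hi : 2 ≤ i) (c : ℝ) :
    V.Complete i c ↔ ∃ σ : Density (V.owned 1), ∀ τ : Density (V.owned 0),
      c ≤ V.acceptProb σ τ := by
  refine ⟨fun h => ?_, fun ⟨σ, hσ⟩ => V.play_start_of_winning hi rfl σ hσ⟩
  by_contra! hne
  -- `b` is optimal for the second player, who minimizes, and `a` for the first. Some `τ` keeps `a`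
  -- below `c`, so the saddle inequality keeps `b` below `c` against every `σ`.
  obtain ⟨b, a, hab⟩ := V.exists_saddlePoint (V.owned 0) (V.owned 1)
  obtain ⟨τ, hτ⟩ := hne a
  refine (V.not_play i (e := 1) (e' := 0) rfl _ _ _ _ _).2
    (V.play_start_of_winning hi (e' := 1) rfl b fun σ => ?_) h
  rw [V.acceptProb_comm] at hτ
  exact not_le.2 ((hab τ σ).trans_lt hτ)

/-- With at least two turns, soundness says that the second player has a final state which is good
against every final state of the first player. -/
theorem sound_iff {i : ℕ} (hi : 2 ≤ i) (s : ℝ) :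
    V.Sound i s ↔ ∃ τ : Density (V.owned 0), ∀ σ : Density (V.owned 1),
      V.acceptProb τ σ ≤ s := by
  refine ⟨fun h => ?_, fun ⟨τ, hτ⟩ => V.play_start_of_winning hi rfl τ hτ⟩
  by_contra! hne
  -- Dually, some `σ` exceeds `s` against `b`, so `a` exceeds `s` against every `τ`.
  obtain ⟨b, a, hab⟩ := V.exists_saddlePoint (V.owned 0) (V.owned 1)
  obtain ⟨σ, hσ⟩ := hne b
  refine (V.not_play i (e := 0) (e' := 1) rfl _ _ _ _ _).2
    (V.play_start_of_winning hi (e' := 0) rfl a fun τ => ?_) h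
  rw [V.acceptProb_comm]
  exact not_le.2 (hσ.trans_le (hab τ σ))

/-! ### The size of the registers -/

theorem card_register_le_of_two {i B : ℕ} (hi : 2 ≤ i)
    (h : ∀ j, 1 ≤ j → j ≤ 2 → (V.register 2 j).card ≤ B) {j : ℕ} (hj : 1 ≤ j) :
    (V.register i j).card ≤ B := by
  -- With two turns, odd labels go to register 1 and positive even ones to register 2; `2 - j % 2`
  -- selects by parity.
  have hsub : V.register i j ⊆ V.register 2 (2 - j % 2) := by
    intro w
    simp only [mem_register, turn]
    split_ifs <;> omega
  exact (Finset.card_le_card hsub).trans (h _ (by omega) (by omega))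

theorem card_register_two_le {i B : ℕ} (hi : 2 ≤ i)
    (h : ∀ j, 1 ≤ j → j ≤ i → (V.register i j).card ≤ B) {j : ℕ} (hj : 1 ≤ j) :
    (V.register 2 j).card ≤ i * B := by
  -- Every proof qubit lies in one of the `i` registers, whence the factor `i`.
  have hsub : V.register 2 j ⊆ (Finset.Icc 1 i).biUnion (V.register i) := by
    intro w
    simp only [Finset.mem_biUnion, Finset.mem_Icc, mem_register, exists_eq_right', turn]
    split_ifs <;> omega
  refine (Finset.card_le_card hsub).trans
    ((Finset.card_biUnion_le_card_mul _ _ B fun l hl => ?_).trans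
    (by simp))
  exact h l (Finset.mem_Icc.1 hl).1 (Finset.mem_Icc.1 hl).2

end Circuit

/-! ### Comparison of the levels. -/

theorem qeSigmaWith_two_eq {i : ℕ} (hi : 2 ≤ i) (c s : ℕ → ℝ) :
    QESigmaWith 2 c s = QESigmaWith i c s := by
  ext L
  simp only [QESigmaWith, Set.mem_ofPred_eq, Circuit.complete_iff _ hi, Circuit.sound_iff _ hi,
    Circuit.complete_iff _ le_rfl, Circuit.sound_iff _ le_rfl]
  -- The circuit family and its machine stay the same; the size bound is `p` in one direction and `i
  -- * p`, still polynomial for constant `i`, in the other.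
  refine exists_congr fun V => and_congr_right fun _ => and_congr_left fun _ => ⟨?_, ?_⟩
  · rintro ⟨p, hp⟩
    exact ⟨p, fun x j hj _ => (V x).card_register_le_of_two hi (hp x) hj⟩
  · rintro ⟨p, hp⟩
    refine ⟨Polynomial.C i * p, fun x j hj _ => ?_⟩
    rw [Polynomial.eval_mul, Polynomial.eval_C]
    exact (V x).card_register_two_le hi (hp x) hj

end QEPH

end

theorem mainTheorem1 (i : ℕ) (hi : 2 ≤ i) : QEPH.QESigma 2 = QEPH.QESigma i := by
  simp only [QEPH.QESigma, QEPH.qeSigmaWith_two_eq hi]
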